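/- Let $k$ be an algebraically closed field, $V$ a scheme over $k$ (for instance a nearly projective variety), and $\{E_i\}_{i\in N}$ a collection of line bundles on $V$ indexed by a finite set $N$ (for instance a decent collection of $\mathbb G_m$-equivariant line bundles). Let $Q$ be a quiver with set of nodes $N$ and $I$ a two-sided ideal of its path algebra $P(Q)$, homogeneous for the grading $P(Q)=\bigoplus_{i,j} P_{ij}(Q)$ by end points, together with an isomorphism of $k$-algebras $P(Q)/I\cong \operatorname{End}(\bigoplus_i E_i)^{\mathrm{op}}$ that matches the idempotents of the nodes with those of the summands $E_i$ (for instance the Bondal quiver with relations of the collection); thus paths from $j$ to $i$ give elements of $\operatorname{Hom}(E_i,E_j)$. Let $R$ be the affine variety of representations of $(Q,I)$ in which every node is mapped to the line $k$, and let $B$ be its coordinate ring, generated by the matrix entries of the arrows. The group $G=\big(\prod_{i\in N}\mathrm{GL}_1(k)\big)/k^\times_{\mathrm{diag}}$ acts on $R$: for an arrow $x$ from $i$ to $j$, $(g\cdot a)(x)=g_j\,a(x)\,g_i^{-1}$; it acts on $B$ by $(g\cdot f)(a)=f(g^{-1}\cdot a)$. For a character $\chi=(\chi_i)\in\mathbb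 Z^N$ with $\sum_i\chi_i=0$, that is $g\mapsto\prod_i g_i^{\chi_i}$, a point $a\in R$ is $\chi$-semistable if some $f\in B$ with $g\cdot f=\chi(g)^r f$ for all $g \in G$ and some $r>0$ satisfies $f(a)\ne0$; it is $\chi$-stable if it is $\chi$-semistable, its stabilizer in $G$ is finite, and its $G$-orbit is Zariski closed in the semistable locus. These notions depend only on the isomorphism class of the representation. For a $k$-point $p$ of $V$ with structure sheaf $\mathcal O_p$, the tautological representation $T(p)$ has the space $\operatorname{Hom}(E_i,\mathcal O_p)$ at the node $i$, with $P(Q)/I\cong\operatorname{End}(\bigoplus_i E_i)^{\mathrm{op}}$ acting by composition. Let $\{m_{ij}\}_{i,j\in N}$ be non-negative integers and put $\chi_\ell=\sum_{i} m_{i\ell}-\sum_{j} m_{\ell j}$. Suppose that $\{m_{ij}\}$ is *sufficient*, that is: 1. $\mathcal{H}om(E_i,E_j)$ is generated by global sections whenever $m_{ij}\neq 0$; 2. it is possible to get from any node of $Q$ to any other by finitely many steps, each of which goes either from a node $j$ to a node $i$ such that $\mathcal{H}om(E_i,E_j)$ is generated by global sections, or from a node $i$ to a node $j$ such that $m_{ij}\neq0$.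 Then $\chi$ is great: for every $k$-point $p$ of $V$ the representation $T(p)$ has dimension vector $(1,\dots,1)$ and is $\chi$-stable. -/

import Mathlib

open CategoryTheory AlgebraicGeometry

universe u v w

/-! ### Representations of a quiver with relations, all of whose nodes carry the line `k` -/

namespace BondalQuiver

/-- `P_{ij}(Q)`: the `k`-vector space spanned by the paths from `i` to `j` in the quiver `Q`
(which is given by the instance `Quiver ι` on the set `ι` of nodes). -/
abbrev PathSpace (k : Type u) [Field k] {ι : Type v} [Quiver.{w} ι] (i j : ι) : Type _ :=
  Quiver.Path i j →₀ k

/-- Multiplication in the path algebra: the bilinear extension of concatenation of paths. -/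
noncomputable def PathSpace.comp {k : Type u} [Field k] {ι : Type v} [Quiver.{w} ι] {i j l : ι}
    (x : PathSpace k i j) (y : PathSpace k j l) : PathSpace k i l :=
  x.sum fun p c => y.sum fun q d => Finsupp.single (p.comp q) (c * d)

/-- A two-sided ideal of the path algebra `P(Q) = ⨁ P_{ij}(Q)`, homogeneous for this grading. -/
structure PathIdeal (k : Type u) [Field k] (ι : Type v) [Quiver.{w} ι] where
  /-- The component in `P_{ij}(Q)`. -/
  carrier : ∀ i j : ι, Submodule k (PathSpace k i j)
  comp_mem_left : ∀ {i j l : ι} (x : PathSpace k i j) (y : PathSpace k j l),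
    y ∈ carrier j l → x.comp y ∈ carrier i l
  comp_mem_right : ∀ {i j l : ι} (x : PathSpace k i j) (y : PathSpace k j l),
    x ∈ carrier i j → x.comp y ∈ carrier i l

/-- The value on an element of `P_{ij}(Q)` of an assignment of scalars (that is, of linear maps
`k → k`) to the arrows: a path goes to the product over its arrows. -/
noncomputable def evalPath {k : Type u} [Field k] {ι : Type v} [Quiver.{w} ι]
    (a : ∀ {i j : ι}, (i ⟶ j) → k) {i j : ι} (x : PathSpace k i j) : k :=
  x.sum fun p c => c * p.weight a

/-- `R_α(Q, I)` for `α = (1, …, 1)`: the representations of the quiver with relations `(Q, I)`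
in which every node is mapped to the coordinate line `k`. -/
@[ext]
structure Rep {k : Type u} [Field k] {ι : Type v} [Quiver.{w} ι] (I : PathIdeal k ι) where
  /-- The linear map `k → k` attached to an arrow. -/
  val : ∀ {i j : ι}, (i ⟶ j) → k
  relations : ∀ {i j : ι}, ∀ x ∈ I.carrier i j, evalPath val x = 0

/-- The group `∏ GL(1)` acting by change of basis. -/
abbrev Torus (k : Type u) [Field k] (ι : Type v) : Type _ := ι → kˣ

/-- The diagonal copy of the multiplicative group in `∏ GL(1)`. -/
abbrev diagonal (k : Type u) [Field k] (ι : Type v) : Subgroup (Torus k ι) :=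
  (Pi.constMonoidHom ι kˣ).range

/-- `G = (∏ GL(1)) / 𝔾ₘ`, the quotient by the diagonal. -/
abbrev GaugeGroup (k : Type u) [Field k] (ι : Type v) : Type _ := Torus k ι ⧸ diagonal k ι

section Action

variable {k : Type u} [Field k] {ι : Type v} [Quiver.{w} ι]

lemma weight_twist (g : Torus k ι) (a : ∀ {i j : ι}, (i ⟶ j) → k) {i j : ι}
    (p : Quiver.Path i j) :
    p.weight (fun {i j} (x : i ⟶ j) => (g j : k) * a x * ((g i)⁻¹ : kˣ)) =
      (g j : k) * p.weight a * ((g i)⁻¹ : kˣ) := by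
  induction p with
  | nil => simp
  | cons p e ih =>
    simp only [Quiver.Path.weight_cons, ih]
    rename_i b c
    have h : ((g b : kˣ) : k) * ((g b)⁻¹ : kˣ) = 1 := by simp
    linear_combination ((g c : k) * a e * p.weight a * ((g i)⁻¹ : kˣ)) * h

lemma evalPath_twist (g : Torus k ι) (a : ∀ {i j : ι}, (i ⟶ j) → k) {i j : ι}
    (x : PathSpace k i j) :
    evalPath (fun {i j} (x : i ⟶ j) => (g j : k) * a x * ((g i)⁻¹ : kˣ)) x =
      (g j : k) * evalPath a x * ((g i)⁻¹ : kˣ) := by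
  simp only [evalPath, Finsupp.sum, weight_twist, Finset.mul_sum, Finset.sum_mul]
  refine Finset.sum_congr rfl fun p _ => ?_
  ring

/-- The action of `∏ GL(1)`: an arrow `x` from `i` to `j` has `(g • a)(x) = g_j a(x) g_i⁻¹`. -/
instance torusAction (I : PathIdeal k ι) : MulAction (Torus k ι) (Rep I) where
  smul g a :=
    { val := fun {i j} (x : i ⟶ j) => (g j : k) * a.val x * ((g i)⁻¹ : kˣ)
      relations := fun x hx => by
        rw [evalPath_twist, a.relations x hx, mul_zero, zero_mul] }
  one_smul a := by
    apply Rep.ext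
    funext i j x
    change ((1 : kˣ) : k) * a.val x * ((1⁻¹ : kˣ) : k) = a.val x
    simp
  mul_smul g h a := by
    apply Rep.ext
    funext i j x
    change ((g j * h j : kˣ) : k) * a.val x * (((g i * h i)⁻¹ : kˣ) : k) =
      (g j : k) * ((h j : k) * a.val x * ((h i)⁻¹ : kˣ)) * ((g i)⁻¹ : kˣ)
    rw [mul_inv, Units.val_mul, Units.val_mul]
    ring

@[simp]
lemma torus_smul_val {I : PathIdeal k ι} (g : Torus k ι) (a : Rep I) {i j : ι} (x : i ⟶ j) :
    (g • a).val x = (g j : k) * a.val x * ((g i)⁻¹ : kˣ) := rfl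

lemma diagonal_le_ker (I : PathIdeal k ι) :
    diagonal k ι ≤ (MulAction.toPermHom (Torus k ι) (Rep I)).ker := by
  rintro _ ⟨c, rfl⟩
  rw [MonoidHom.mem_ker]
  ext1 a
  apply Rep.ext
  funext i j x
  change (c : k) * a.val x * ((c⁻¹ : kˣ) : k) = a.val x
  rw [mul_comm, ← mul_assoc]
  simp

/-- The induced action of `G`. -/
noncomputable instance gaugeAction (I : PathIdeal k ι) : MulAction (GaugeGroup k ι) (Rep I) :=
  MulAction.compHom (Rep I) (QuotientGroup.lift (diagonal k ι)
    (MulAction.toPermHom (Torus k ι) (Rep I)) (diagonal_le_ker I))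

@[simp]
lemma gauge_mk_smul {I : PathIdeal k ι} (g : Torus k ι) (a : Rep I) :
    (QuotientGroup.mk g : GaugeGroup k ι) • a = g • a := rfl

end Action

/-- The character `g ↦ ∏ g_i ^ χ_i` of `∏ GL(1)`. -/
def torusCharacter (k : Type u) [Field k] {ι : Type v} [Fintype ι] (χ : ι → ℤ) :
    Torus k ι →* kˣ where
  toFun g := ∏ i, g i ^ χ i
  map_one' := by simp
  map_mul' g h := by simp [mul_zpow, Finset.prod_mul_distrib]

/-- For `∑ χ_i = 0`, the character of `G` induced by `g ↦ ∏ g_i ^ χ_i`. -/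
def character (k : Type u) [Field k] {ι : Type v} [Fintype ι] (χ : ι → ℤ) (hχ : ∑ i, χ i = 0) :
    GaugeGroup k ι →* kˣ :=
  QuotientGroup.lift (diagonal k ι) (torusCharacter k χ) (by
    rintro _ ⟨c, rfl⟩
    rw [MonoidHom.mem_ker]
    change ∏ i, c ^ χ i = 1
    rw [← zpow_zero c, ← hχ]
    exact (map_sum (AddMonoidHom.mk' (fun n : ℤ => Additive.ofMul (c ^ n))
      (fun a b => by rw [zpow_add, ofMul_mul])) χ Finset.univ).symm)

/-- `B`: the coordinate ring of the affine variety `R_α(Q, I)`, that is, the algebra of those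
functions that are polynomials in the matrix entries of the arrows. -/
def coordRing {k : Type u} [Field k] {ι : Type v} [Quiver.{w} ι] (I : PathIdeal k ι) :
    Subalgebra k (Rep I → k) :=
  Algebra.adjoin k {f | ∃ (i j : ι) (x : i ⟶ j), f = fun a : Rep I => a.val x}

/-- `B(θ)`: the `θ`-eigenspace for the induced action `(g • f)(a) = f (g⁻¹ • a)` of `G` on `B`. -/
def IsEigenfunction {k : Type u} [Field k] {ι : Type v} [Quiver.{w} ι] {I : PathIdeal k ι}
    (θ : GaugeGroup k ι →* kˣ) (f : Rep I → k) : Prop :=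
  f ∈ coordRing I ∧ ∀ (g : GaugeGroup k ι) (a : Rep I), f (g⁻¹ • a) = (θ g : k) * f a

/-- `a` is `θ`-semistable: some `f ∈ B(rθ)` with `r > 0` does not vanish at `a`. -/
def IsSemistable {k : Type u} [Field k] {ι : Type v} [Quiver.{w} ι] {I : PathIdeal k ι}
    (θ : GaugeGroup k ι →* kˣ) (a : Rep I) : Prop :=
  ∃ r : ℕ, 0 < r ∧ ∃ f : Rep I → k, IsEigenfunction (θ ^ r) f ∧ f a ≠ 0

/-- Zariski closed subsets of `R_α(Q, I)`: the zero loci of sets of regular functions. -/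
def IsZariskiClosed {k : Type u} [Field k] {ι : Type v} [Quiver.{w} ι] {I : PathIdeal k ι}
    (Z : Set (Rep I)) : Prop :=
  ∃ S : Set (Rep I → k), S ⊆ coordRing I ∧ Z = {a | ∀ f ∈ S, f a = 0}

/-- `a` is `θ`-stable: it is `θ`-semistable, its stabilizer in `G` is finite, and its `G`-orbit is
closed in the semistable locus. -/
def IsStable {k : Type u} [Field k] {ι : Type v} [Quiver.{w} ι] {I : PathIdeal k ι}
    (θ : GaugeGroup k ι →* kˣ) (a : Rep I) : Prop :=
  IsSemistable θ a ∧
  (MulAction.stabilizer (GaugeGroup k ι) a : Set (GaugeGroup k ι)).Finite ∧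
  ∃ Z : Set (Rep I), IsZariskiClosed Z ∧
    MulAction.orbit (GaugeGroup k ι) a = Z ∩ {b | IsSemistable θ b}

/-! ### Sheaves of modules on a scheme over a field -/

/-- Multiplication by a global function `c` on the sections over `U`. -/
noncomputable def mulSection {V : Scheme.{u}} (M : V.Modules) (c : Γ(V, ⊤)) (U : V.Opens) :
    Γ(M, U) →ₗ[Γ(V, U)] Γ(M, U) :=
  LinearMap.lsmul Γ(V, U) Γ(M, U) (V.presheaf.map U.leTop.op c)

/-- Multiplication by a global function `c`, as an endomorphism of a sheaf of modules. -/
noncomputable def mulGlobal {V : Scheme.{u}} (M : V.Modules) (c : Γ(V, ⊤)) : M ⟶ M where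
  val :=
    { app := fun U => ModuleCat.ofHom (Y := M.val.obj U)
        { toFun := fun x => mulSection M c U.unop x
          map_add' := fun x y => map_add (mulSection M c U.unop) x y
          map_smul' := fun r x => (mulSection M c U.unop).map_smul' r x }
      naturality := fun {U W} f => by
        ext x
        have h := M.map_smul f.unop (V.presheaf.map U.unop.leTop.op c) x
        rw [← CommRingCat.comp_apply, ← Functor.map_comp] at h
        exact h.symm }

@[simp]
lemma mulGlobal_app {V : Scheme.{u}} (M : V.Modules) (c : Γ(V, ⊤)) (U : V.Opens) (x : Γ(M, U)) :
    (mulGlobal M c).app U x = V.presheaf.map U.leTop.op c • x := rfl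

/-- A scalar, as a global function on a scheme over `Spec k`. -/
noncomputable def scalar {k : Type u} [Field k] (V : Scheme.{u}) [V.Over (Spec (.of k))] :
    k →+* Γ(V, ⊤) :=
  (V ↘ Spec (.of k)).appTop.hom.comp (Scheme.ΓSpecIso (.of k)).inv.hom

/-- For a scheme `V` over `Spec k`, the category of `𝒪_V`-modules is `k`-linear:
`(c • φ)(x) = c φ(x)`. -/
noncomputable instance modulesLinear (k : Type u) [Field k] (V : Scheme.{u})
    [V.Over (Spec (.of k))] : Linear k V.Modules where
  homModule M N :=
    { smul := fun c φ => φ ≫ mulGlobal N (scalar V c)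
      one_smul := fun φ => by
        ext U x
        change V.presheaf.map U.leTop.op (scalar V (1 : k)) • φ.app U x = φ.app U x
        rw [map_one, map_one, one_smul]
      mul_smul := fun c d φ => by
        ext U x
        change V.presheaf.map U.leTop.op (scalar V (c * d)) • φ.app U x =
          V.presheaf.map U.leTop.op (scalar V c) • V.presheaf.map U.leTop.op (scalar V d) •
            φ.app U x
        rw [map_mul, map_mul, mul_smul]
      smul_zero := fun c => Limits.zero_comp
      smul_add := fun c φ ψ => Preadditive.add_comp _ _ _ _ _ _
      add_smul := fun c d φ => by
        ext U x
        change V.presheaf.map U.leTop.op (scalar V (c + d)) • φ.app U x =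
          V.presheaf.map U.leTop.op (scalar V c) • φ.app U x +
            V.presheaf.map U.leTop.op (scalar V d) • φ.app U x
        rw [map_add, map_add, add_smul]
      zero_smul := fun φ => by
        ext U x
        change V.presheaf.map U.leTop.op (scalar V (0 : k)) • φ.app U x = 0
        rw [map_zero, map_zero, zero_smul] }
  smul_comp M N K c φ ψ := by
    ext U x
    change ψ.app U (V.presheaf.map U.leTop.op (scalar V c) • φ.app U x) =
      V.presheaf.map U.leTop.op (scalar V c) • ψ.app U (φ.app U x)
    exact Scheme.Modules.Hom.app_smul _ _ _
  comp_smul M N K φ c ψ := (Category.assoc _ _ _).symm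

/-- Line bundles: `𝒪_V`-modules locally isomorphic to `𝒪_V`. -/
def IsLineBundle {V : Scheme.{u}} (M : V.Modules) : Prop :=
  ∀ x : V, ∃ U : V.Opens, x ∈ U ∧
    Nonempty (M.restrict U.ι ≅ SheafOfModules.unit (U : Scheme.{u}).ringCatSheaf)

/-- The sheaf `𝓗om(M, N)`, whose sections over `U` are the morphisms `M|_U ⟶ N|_U`, is generated
by global sections: every local section is, near each point of its domain, a finite linear
combination, with coefficients local functions, of restrictions of morphisms `M ⟶ N`. -/
def HomGloballyGenerated {V : Scheme.{u}} (M N : V.Modules) : Prop :=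
  ∀ (U : V.Opens) (f : M.restrict U.ι ⟶ N.restrict U.ι) (x : (U : Scheme.{u})),
    ∃ (W : (U : Scheme.{u}).Opens) (d : ℕ) (c : Fin d → Γ((U : Scheme.{u}), W))
      (s : Fin d → (M ⟶ N)), x ∈ W ∧
      ∀ (W' : (U : Scheme.{u}).Opens) (h : W' ≤ W) (y : Γ(M.restrict U.ι, W')),
        f.app W' y = ∑ l, ((U : Scheme.{u}).presheaf.map (homOfLE h).op (c l)) •
          ((Scheme.Modules.restrictFunctor U.ι).map (s l)).app W' y

/-- The structure sheaf `𝒪_p` of a `k`-rational point `p`, as an `𝒪_V`-module. -/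
noncomputable def pointSheaf {k : Type u} [Field k] {V : Scheme.{u}} (p : Spec (.of k) ⟶ V) :
    V.Modules :=
  (Scheme.Modules.pushforward p).obj (SheafOfModules.unit (Spec (.of k)).ringCatSheaf)

/-! ### Quivers with relations of a collection of sheaves -/

/-- An isomorphism `P(Q)/I ≅ End(⨁ E_i)ᵒᵖ` of `k`-algebras that matches the idempotents `e_i`.
So paths from `i` to `j` are sent to morphisms from `E_j` to `E_i`. -/
structure PathAlgebraIso {k : Type u} [Field k] {V : Scheme.{u}} [V.Over (Spec (.of k))]
    {ι : Type v} [Quiver.{w} ι] (I : PathIdeal k ι) (E : ι → V.Modules) where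
  /-- The isomorphism in each component. -/
  equiv : ∀ i j : ι, (PathSpace k i j ⧸ I.carrier i j) ≃ₗ[k] (E j ⟶ E i)
  map_one : ∀ i : ι, equiv i i (Submodule.Quotient.mk (Finsupp.single .nil 1)) = 𝟙 (E i)
  map_comp : ∀ {i j l : ι} (x : PathSpace k i j) (y : PathSpace k j l),
    equiv i l (Submodule.Quotient.mk (x.comp y)) =
      equiv j l (Submodule.Quotient.mk y) ≫ equiv i j (Submodule.Quotient.mk x)

/-- The morphism `E_j ⟶ E_i` corresponding to an arrow from `i` to `j`. -/
noncomputable def PathAlgebraIso.arrow {k : Type u} [Field k] {V : Scheme.{u}}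
    [V.Over (Spec (.of k))] {ι : Type v} [Quiver.{w} ι] {I : PathIdeal k ι} {E : ι → V.Modules}
    (φ : PathAlgebraIso I E) {i j : ι} (x : i ⟶ j) : E j ⟶ E i :=
  φ.equiv i j (Submodule.Quotient.mk (Finsupp.single x.toPath 1))

/-- The tautological representation `T(p) = F(𝒪_p)` has the vector space `Hom(E_i, 𝒪_p)` at the
node `i`, and the morphisms between the `E_i` act by composition. This says that `T(p)` is
isomorphic to the representation `a` on coordinate lines. -/
def IsoTautological {k : Type u} [Field k] {V : Scheme.{u}} [V.Over (Spec (.of k))]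
    {ι : Type v} [Quiver.{w} ι] {I : PathIdeal k ι} {E : ι → V.Modules}
    (φ : PathAlgebraIso I E) (p : Spec (.of k) ⟶ V) (a : Rep I) : Prop :=
  ∃ e : ∀ i : ι, (E i ⟶ pointSheaf p) ≃ₗ[k] k,
    ∀ {i j : ι} (x : i ⟶ j) (t : E i ⟶ pointSheaf p), e j (φ.arrow x ≫ t) = a.val x * e i t

/-- The character `θ` is great: for every `k`-point `p` of `V` the tautological representation
`T(p)` is `θ`-stable (it has the dimension vector `(1, …, 1)`, and the points of `R_α(Q, I)` that
are isomorphic to it are `θ`-stable). -/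
def IsGreat {k : Type u} [Field k] {V : Scheme.{u}} [V.Over (Spec (.of k))]
    {ι : Type v} [Quiver.{w} ι] {I : PathIdeal k ι} {E : ι → V.Modules}
    (φ : PathAlgebraIso I E) (θ : GaugeGroup k ι →* kˣ) : Prop :=
  ∀ p : Spec (.of k) ⟶ V, p ≫ (V ↘ Spec (.of k)) = 𝟙 _ →
    (∃ a : Rep I, IsoTautological φ p a) ∧ ∀ a : Rep I, IsoTautological φ p a → IsStable θ a

/-- `χ_l = ∑_i m_{il} - ∑_j m_{lj}`. -/
def chi {ι : Type v} [Fintype ι] (m : ι → ι → ℕ) (l : ι) : ℤ :=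
  ∑ i, (m i l : ℤ) - ∑ j, (m l j : ℤ)

lemma sum_chi {ι : Type v} [Fintype ι] (m : ι → ι → ℕ) : ∑ l, chi m l = 0 := by
  simp only [chi, Finset.sum_sub_distrib]
  rw [Finset.sum_comm, sub_self]

/-- `{m_{ij}}` is sufficient: `𝓗om(E_i, E_j)` is globally generated whenever `m_{ij} ≠ 0`, and one
can get from any node to any other by steps from `j` to `i` with `𝓗om(E_i, E_j)` globally
generated, and steps from `i` to `j` with `m_{ij} ≠ 0`. -/
def Sufficient {V : Scheme.{u}} {ι : Type v} (E : ι → V.Modules) (m : ι → ι → ℕ) : Prop :=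
  (∀ i j : ι, m i j ≠ 0 → HomGloballyGenerated (E i) (E j)) ∧
  ∀ a b : ι, Relation.ReflTransGen
    (fun s t : ι => HomGloballyGenerated (E t) (E s) ∨ m s t ≠ 0) a b

end BondalQuiver

namespace BondalQuiver

/-! A morphism from a line bundle to `𝒪_p` is a functional on its fibre at `p`, so each node of
`T(p)` carries a line. If `𝓗om(E_i, E_j)` is globally generated, some `E_i ⟶ E_j` is nonzero at `p`,
and hence some path from `j` to `i` has nonzero weight on `T(p)` (`exists_path`). The rest is torus
geometry (`isStable_of_paths`).

Let `a` represent `T(p)`, and for `m_{ij} ≠ 0` let `w_{ij}` be the weight of such a path; it scales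
by `g_i / g_j`. Then `F = ∏ w_{ij}^{m_{ij}}` is a `χ`-eigenfunction with `F(a) ≠ 0`, which gives
semistability. A nonvanishing path from `s` to `t` forces `g_s = g_t` for `g` fixing `a`, so
connectivity makes the stabilizer trivial.

For closedness, let `b` be a semistable point of the orbit closure. Eigenfunctions of weight `rχ`
are proportional to `F^r` there, so `F(b) ≠ 0` and each `w_{ij}` with `m_{ij} ≠ 0` is invertible at
`b`. Steps with `m_{ij} ≠ 0` may therefore be walked backwards along `w_{ij}`. Connectivity then
yields rational functions scaling by `g_t / g_s`, regular and nonzero at both `a` and `b`; their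
values give the torus element that carries `a` to `b` (`exists_smul_eq`). -/

lemma character_mk_eq_prod {k : Type u} [Field k] {ι : Type v} [Fintype ι] (m : ι → ι → ℕ) (g : Torus k ι) :
    character k (chi m) (sum_chi m) (QuotientGroup.mk g) =
      ∏ i, ∏ j, ((g i)⁻¹ * g j) ^ m i j := by
  change ∏ l, g l ^ chi m l = _
  -- The exponent of `g_l` collects `m_{il}` from the factors `(i, l)` and `-m_{lj}` from the
  -- factors `(l, j)`.
  simp only [chi, zpow_sub, Finset.prod_mul_distrib, mul_pow, ← Nat.cast_sum, zpow_natCast, inv_pow,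
    Finset.prod_inv_distrib, Finset.prod_pow_eq_pow_sum]
  rw [Finset.prod_comm, mul_comm]
  simp only [Finset.prod_pow_eq_pow_sum]

/-! ### Stability from nonvanishing paths -/

section Stability

variable {k : Type u} [Field k] {ι : Type v} [Quiver.{w} ι] {I : PathIdeal k ι}

lemma weight_mem_coordRing {i j : ι} (q : Quiver.Path i j) :
    (fun a : Rep I => q.weight a.val) ∈ coordRing I := by
  induction q with
  | nil =>
    simp only [Quiver.Path.weight_nil]
    exact one_mem (coordRing I)
  | cons q x ih =>
    simp only [Quiver.Path.weight_cons]
    exact mul_mem ih (Algebra.subset_adjoin ⟨_, _, x, rfl⟩)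

lemma weight_smul (g : Torus k ι) (a : Rep I) {i j : ι} (q : Quiver.Path i j) :
    q.weight (g • a).val = (g j : k) * q.weight a.val * ((g i)⁻¹ : kˣ) :=
  weight_twist g a.val q

/-- The Zariski closure of the orbit of `a`. -/
def orbitClosure (a : Rep I) : Set (Rep I) :=
  {b | ∀ f ∈ {f | f ∈ coordRing I ∧ ∀ g : Torus k ι, f (g • a) = 0}, f b = 0}

lemma isZariskiClosed_orbitClosure (a : Rep I) : IsZariskiClosed (orbitClosure a) :=
  ⟨_, fun _ hf => hf.1, rfl⟩

/-- If two regular functions are proportional on the orbit of `a`, then they are so on its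
closure. -/
lemma mul_eq_mul_of_mem_orbitClosure {a b : Rep I} (hb : b ∈ orbitClosure a)
    {f h : Rep I → k} (hf : f ∈ coordRing I) (hh : h ∈ coordRing I)
    (H : ∀ g : Torus k ι, f (g • a) * h a = f a * h (g • a)) : f b * h a = f a * h b := by
  have := hb (h a • f - f a • h) ⟨sub_mem (Subalgebra.smul_mem _ hf _)
    (Subalgebra.smul_mem _ hh _), fun g => by
      simp only [Pi.sub_apply, Pi.smul_apply, smul_eq_mul]
      linear_combination H g⟩
  simp only [Pi.sub_apply, Pi.smul_apply, smul_eq_mul] at this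
  linear_combination this

/-- There are regular functions `N`, `D`, not vanishing at `a`, whose ratio transforms by `g_t / g_s`
on the orbit of `a`, and `D` does not vanish at `b`. -/
def HasTransition (a b : Rep I) (s t : ι) : Prop :=
  ∃ N ∈ coordRing I, ∃ D ∈ coordRing I, N a ≠ 0 ∧ D a ≠ 0 ∧ D b ≠ 0 ∧
    ∀ g : Torus k ι, N (g • a) * D a * g s = g t * N a * D (g • a)

lemma HasTransition.refl (a b : Rep I) (s : ι) : HasTransition a b s s :=
  ⟨1, one_mem _, 1, one_mem _, by simp, by simp, by simp, fun g => by simp⟩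

lemma HasTransition.trans {a b : Rep I} {s t l : ι} (h : HasTransition a b s t)
    (h' : HasTransition a b t l) : HasTransition a b s l := by
  obtain ⟨N, hN, D, hD, h1, h2, h3, h4⟩ := h
  obtain ⟨N', hN', D', hD', h1', h2', h3', h4'⟩ := h'
  refine ⟨N * N', mul_mem hN hN', D * D', mul_mem hD hD', mul_ne_zero h1 h1',
    mul_ne_zero h2 h2', mul_ne_zero h3 h3', fun g => ?_⟩
  simp only [Pi.mul_apply]
  linear_combination N' (g • a) * D' a * h4 g + N a * D (g • a) * h4' g

/-- In a strongly connected situation, the functions `N` do not vanish at a point `b` of the orbit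
closure either. -/
lemma HasTransition.exists_ne_zero {a b : Rep I} (hb : b ∈ orbitClosure a) {s t : ι}
    (h : HasTransition a b s t) (h' : HasTransition a b t s) :
    ∃ N ∈ coordRing I, ∃ D ∈ coordRing I, N a ≠ 0 ∧ D a ≠ 0 ∧ N b ≠ 0 ∧ D b ≠ 0 ∧
      ∀ g : Torus k ι, N (g • a) * D a * g s = g t * N a * D (g • a) := by
  obtain ⟨N, hN, D, hD, h1, h2, h3, h4⟩ := h
  obtain ⟨N', hN', D', hD', h1', h2', h3', h4'⟩ := h'
  refine ⟨N, hN, D, hD, h1, h2, fun h0 => ?_, h3, h4⟩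
  -- The factors `g_t / g_s` and `g_s / g_t` cancel, so `N N'` is a nonzero constant multiple of `D
  -- D'` on the orbit, hence at `b`, where `D D'` is nonzero.
  have key := mul_eq_mul_of_mem_orbitClosure hb (mul_mem hN hN') (mul_mem hD hD') fun g => by
    have hs : (g s : k) ≠ 0 := (g s).ne_zero
    have ht : (g t : k) ≠ 0 := (g t).ne_zero
    refine mul_left_cancel₀ (mul_ne_zero hs ht) ?_
    simp only [Pi.mul_apply]
    linear_combination N' (g • a) * D' a * g t * h4 g + N a * D (g • a) * g t * h4' g
  simp only [Pi.mul_apply, h0, zero_mul] at key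
  exact mul_ne_zero (mul_ne_zero h1 h1') (mul_ne_zero h3 h3') key.symm

/-- Transitions from a base node `o` act as coordinates `g_l / g_o` on the orbit that extend to `b`,
so the group element can be read off at `b`. -/
lemma exists_smul_eq {a b : Rep I} (hb : b ∈ orbitClosure a)
    (H : ∀ s t, HasTransition a b s t) : ∃ g : Torus k ι, g • a = b := by
  rcases isEmpty_or_nonempty ι with hι | ⟨⟨o⟩⟩
  · exact ⟨1, Rep.ext (funext fun i => hι.elim i)⟩
  choose N hN D hD hNa hDa hNb hDb hND using fun l => (H o l).exists_ne_zero hb (H l o)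
  -- The value at `b` of the transition `N_l / D_l`, divided by its value at `a`.
  refine ⟨fun l => Units.mk0 (N l b * D l a / (D l b * N l a))
    (div_ne_zero (mul_ne_zero (hNb l) (hDa l)) (mul_ne_zero (hDb l) (hNa l))), ?_⟩
  apply Rep.ext
  funext i j x
  -- The entry of `x` times `(N_i / D_i) / (N_j / D_j)` is invariant along the orbit; clearing
  -- denominators gives two proportional regular functions.
  have key := mul_eq_mul_of_mem_orbitClosure hb
    (f := (fun c => c.val x) * (N i * D j)) (h := N j * D i)
    (mul_mem (Algebra.subset_adjoin ⟨_, _, x, rfl⟩) (mul_mem (hN i) (hD j)))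
    (mul_mem (hN j) (hD i)) fun g => by
      have ho : (g o : k) ≠ 0 := (g o).ne_zero
      have hi : (g i : k) * ((g i)⁻¹ : kˣ) = 1 := by simp
      refine mul_left_cancel₀ (mul_ne_zero ho ho) ?_
      simp only [Pi.mul_apply, torus_smul_val]
      linear_combination (g o * g j * a.val x * ((g i)⁻¹ : kˣ) * D j (g • a) * N j a) * hND i g
        + (g o * g j * a.val x * N i a * D i (g • a) * D j (g • a) * N j a) * hi
        - (g o * a.val x * N i a * D i (g • a)) * hND j g
  simp only [Pi.mul_apply] at key
  rw [torus_smul_val]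
  simp only [Units.val_mk0, Units.val_inv_eq_inv_val]
  have := hNa i
  have := hNa j
  have := hNb i
  have := hNb j
  have := hDa i
  have := hDa j
  have := hDb i
  have := hDb j
  field_simp
  linear_combination -key

lemma IsSemistable.smul {θ : GaugeGroup k ι →* kˣ} {a : Rep I} (h : IsSemistable θ a)
    (g : GaugeGroup k ι) : IsSemistable θ (g • a) := by
  obtain ⟨r, hr, f, hf, hfa⟩ := h
  refine ⟨r, hr, f, hf, ?_⟩
  have := (congrArg (fun x => f (x • a)) (inv_inv g)).symm.trans (hf.2 g⁻¹ a)
  exact this ▸ mul_ne_zero (Units.ne_zero _) hfa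

/-- The geometry of `V` enters only through the existence of paths that do not vanish at `a`. -/
theorem isStable_of_paths [Fintype ι] (m : ι → ι → ℕ) (a : Rep I)
    (hm : ∀ i j, m i j ≠ 0 → ∃ q : Quiver.Path j i, q.weight a.val ≠ 0)
    (hc : ∀ s t : ι, Relation.ReflTransGen
      (fun s t => (∃ q : Quiver.Path s t, q.weight a.val ≠ 0) ∨ m s t ≠ 0) s t) :
    IsStable (character k (chi m) (sum_chi m)) a := by
  have hw : ∀ i j, ∃ w ∈ coordRing I, m i j ≠ 0 →
      w a ≠ 0 ∧ ∀ (g : Torus k ι) (c : Rep I), w (g • c) = g i * w c * ((g j)⁻¹ : kˣ) := by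
    intro i j
    by_cases h : m i j = 0
    -- A dummy value: it only occurs with exponent zero in `F`.
    · exact ⟨1, one_mem _, fun h' => (h' h).elim⟩
    · obtain ⟨q, hq⟩ := hm i j h
      exact ⟨_, weight_mem_coordRing q, fun _ => ⟨hq, fun g c => weight_smul g c q⟩⟩
  choose w hwB hw using hw
  -- Used for `b = a` to compute the stabilizer, and for `b` in the orbit closure to prove
  -- closedness.
  have htrans : ∀ b, (∀ i j, m i j ≠ 0 → w i j b ≠ 0) → ∀ s t, HasTransition a b s t := by
    intro b hb s t
    induction hc s t with
    | refl => exact .refl a b s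
    | @tail y z _ hyz ih =>
      refine ih.trans ?_
      rcases hyz with ⟨q, hq⟩ | hyz
      -- A path is used as a numerator, since its weight might vanish at `b`.
      · refine ⟨_, weight_mem_coordRing q, 1, one_mem _, hq, by simp, by simp, fun g => ?_⟩
        have hy : (g y : k) * ((g y)⁻¹ : kˣ) = 1 := by simp
        simp only [weight_smul, Pi.one_apply]
        linear_combination (g z * q.weight a.val) * hy
      -- Here the path runs from `z` to `y`, so its inverse is needed; its weight does not vanish at
      -- `b` by assumption.
      · refine ⟨1, one_mem _, w y z, hwB y z, by simp, (hw y z hyz).1, hb y z hyz, fun g => ?_⟩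
        have hz : (g z : k) * ((g z)⁻¹ : kˣ) = 1 := by simp
        rw [(hw y z hyz).2]
        simp only [Pi.one_apply]
        linear_combination (-(g y * w y z a)) * hz
  set F : Rep I → k := ∏ i, ∏ j, w i j ^ m i j with hF
  have hFapp : ∀ c, F c = ∏ i, ∏ j, w i j c ^ m i j := fun c => by
    simp [hF, Finset.prod_apply]
  have hFB : F ∈ coordRing I :=
    prod_mem fun i _ => prod_mem fun j _ => pow_mem (hwB i j) _
  have hFne : ∀ c, F c ≠ 0 ↔ ∀ i j, m i j ≠ 0 → w i j c ≠ 0 := fun c => by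
    simp only [hFapp, Finset.prod_ne_zero_iff, Finset.mem_univ, true_imp_iff, ne_eq,
      pow_eq_zero_iff', not_and, not_not]
    exact forall₂_congr fun i j => ⟨fun h h1 h2 => h1 (h h2), fun h h1 => by_contra (h · h1)⟩
  have hFa : F a ≠ 0 := (hFne a).2 fun i j h => (hw i j h).1
  have hFeig : IsEigenfunction (character k (chi m) (sum_chi m)) F := by
    refine ⟨hFB, fun g c => ?_⟩
    obtain ⟨g, rfl⟩ := QuotientGroup.mk_surjective g
    rw [character_mk_eq_prod, ← QuotientGroup.mk_inv, gauge_mk_smul, hFapp, hFapp]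
    simp only [Units.coe_prod, Units.val_pow_eq_pow_val, ← Finset.prod_mul_distrib, ← mul_pow]
    refine Finset.prod_congr rfl fun i _ => Finset.prod_congr rfl fun j _ => ?_
    by_cases h : m i j = 0
    · simp [h]
    · rw [(hw i j h).2]
      simp only [Pi.inv_apply, inv_inv, Units.val_mul]
      ring
  have hss : IsSemistable (character k (chi m) (sum_chi m)) a :=
    ⟨1, one_pos, F, ⟨hFB, fun g c => (hFeig.2 g c).trans (by rw [MonoidHom.pow_apply, pow_one])⟩,
      hFa⟩
  refine ⟨hss, ?_, orbitClosure a, isZariskiClosed_orbitClosure a, ?_⟩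
  · refine (Set.finite_singleton 1).subset fun g hg => ?_
    obtain ⟨g, rfl⟩ := QuotientGroup.mk_surjective g
    have hg' : g • a = a := hg
    -- For `g • a = a` the transition has the same nonzero value before and after, so `g_t / g_s =
    -- 1`.
    have hconst : ∀ s t, g s = g t := fun s t => by
      obtain ⟨N, -, D, -, h1, h2, -, h4⟩ := htrans a ((hFne a).1 hFa) s t
      have := h4 g
      rw [hg'] at this
      exact Units.ext (mul_left_cancel₀ (mul_ne_zero h1 h2) (by linear_combination this))
    rw [Set.mem_singleton_iff, QuotientGroup.eq_one_iff]
    rcases isEmpty_or_nonempty ι with hι | ⟨⟨o⟩⟩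
    · exact ⟨1, funext fun i => hι.elim i⟩
    · exact ⟨g o, funext fun i => hconst o i⟩
  · ext b
    constructor
    · rintro ⟨g, rfl⟩
      refine ⟨fun f hf => ?_, hss.smul g⟩
      obtain ⟨g, rfl⟩ := QuotientGroup.mk_surjective g
      exact hf.2 g
    · rintro ⟨hb, r, hr, f, hf, hfb⟩
      -- Both `f` and `F ^ r` have weight `rχ`, so they are proportional on the orbit closure, and
      -- `f b ≠ 0` forces `F b ≠ 0`.
      have key := mul_eq_mul_of_mem_orbitClosure hb hf.1 (pow_mem hFB r) fun g => by
        have h1 := hf.2 (QuotientGroup.mk g⁻¹) a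
        have h2 := hFeig.2 (QuotientGroup.mk g⁻¹) a
        rw [← QuotientGroup.mk_inv, inv_inv, gauge_mk_smul] at h1 h2
        simp only [Pi.pow_apply, h1, h2, MonoidHom.pow_apply, Units.val_pow_eq_pow_val]
        ring
      have hFb : F b ≠ 0 := fun h0 => by
        simp only [Pi.pow_apply, h0, zero_pow hr.ne', mul_zero] at key
        exact mul_ne_zero hfb (pow_ne_zero r hFa) key
      obtain ⟨g, hg⟩ := exists_smul_eq hb (htrans b ((hFne b).1 hFb))
      exact ⟨QuotientGroup.mk g, hg⟩

end Stability

end BondalQuiver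

namespace BondalQuiver

/-! ### Local generators of line bundles -/

section Generators

variable {X : Scheme.{u}}

lemma app_map {M N : X.Modules} (f : M ⟶ N) {U W : X.Opens} (h : W ≤ U) (x : Γ(M, U)) :
    f.app W (M.presheaf.map (homOfLE h).op x) = N.presheaf.map (homOfLE h).op (f.app U x) :=
  congr($(f.mapPresheaf.naturality (homOfLE h).op) x)

lemma map_map (M : X.Modules) {U W W' : X.Opens} (h : W ≤ U) (h' : W' ≤ W) (x : Γ(M, U)) :
    M.presheaf.map (homOfLE h').op (M.presheaf.map (homOfLE h).op x) =
      M.presheaf.map (homOfLE (h'.trans h)).op x :=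
  congr($(M.presheaf.map_comp (homOfLE h).op (homOfLE h').op) x).symm

lemma map_refl (M : X.Modules) {U : X.Opens} (x : Γ(M, U)) :
    M.presheaf.map (homOfLE (le_refl U)).op x = x :=
  congr($(M.presheaf.map_id (.op U)) x)

/-- `σ` generates `M` freely over `U`. -/
def IsGenerator (M : X.Modules) (U : X.Opens) (σ : Γ(M, U)) : Prop :=
  ∀ (W : X.Opens) (h : W ≤ U),
    Function.Bijective fun c : Γ(X, W) => c • M.presheaf.map (homOfLE h).op σ

lemma IsGenerator.map {M : X.Modules} {U : X.Opens} {σ : Γ(M, U)} (hσ : IsGenerator M U σ)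
    {W : X.Opens} (h : W ≤ U) : IsGenerator M W (M.presheaf.map (homOfLE h).op σ) := by
  intro W' h'
  simp only [map_map]
  exact hσ W' (h'.trans h)

/-- The structure sheaf as a module over itself. -/
noncomputable def unitModule (X : Scheme.{u}) : X.Modules :=
  SheafOfModules.unit X.ringCatSheaf

lemma isGenerator_of_iso {M : X.Modules} (e : M ≅ unitModule X) :
    ∃ σ : Γ(M, ⊤), IsGenerator M ⊤ σ := by
  let o (W : X.Opens) : Γ(unitModule X, W) := (1 : Γ(X, W))
  refine ⟨e.inv.app ⊤ (o ⊤), fun W h => ?_⟩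
  have ho : (unitModule X).presheaf.map (homOfLE h).op (o ⊤) = o W :=
    map_one (X.presheaf.map (homOfLE h).op).hom
  have : (fun c : Γ(X, W) => c • M.presheaf.map (homOfLE h).op (e.inv.app ⊤ (o ⊤))) =
      fun c : Γ(X, W) => e.inv.app W (c • o W) := by
    funext c
    rw [← app_map, ho, Scheme.Modules.Hom.app_smul]
  rw [this]
  have h1 : Function.Bijective (e.inv.app W) :=
    ConcreteCategory.bijective_of_isIso (e.inv.app W)
  have h2 : Function.Bijective fun c : Γ(X, W) => c • o W := by
    have : (fun c : Γ(X, W) => c • o W) = fun c : Γ(X, W) => c := funext fun c => mul_one c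
    rw [this]
    exact Function.bijective_id
  exact h1.comp h2

/-- The two scalar actions differ by the ring isomorphism `U.ι.appIso W`, which does not affect
bijectivity. -/
lemma bijective_smul_restrict_iff (M : X.Modules) (U : X.Opens) (W : (U : Scheme.{u}).Opens)
    (y : Γ(M, U.ι ''ᵁ W)) :
    (Function.Bijective fun c : Γ((U : Scheme.{u}), W) =>
      c • (show Γ(M.restrict U.ι, W) from y)) ↔
    Function.Bijective fun c : Γ(X, U.ι ''ᵁ W) => c • y := by
  have h : Function.Bijective (U.ι.appIso W).inv :=
    ConcreteCategory.bijective_of_isIso (U.ι.appIso W).inv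
  exact Function.Bijective.of_comp_iff (fun c : Γ(X, U.ι ''ᵁ W) => c • y) h

lemma isGenerator_restrict_iff (M : X.Modules) (U : X.Opens)
    (σ : Γ(M.restrict U.ι, ⊤)) :
    IsGenerator (M.restrict U.ι) ⊤ σ ↔ IsGenerator M (U.ι ''ᵁ ⊤) σ := by
  constructor
  · intro h W hW
    obtain ⟨W', rfl⟩ : ∃ W', W = U.ι ''ᵁ W' := ⟨U.ι ⁻¹ᵁ W, by
      rw [Scheme.Hom.image_preimage_eq_opensRange_inf, ← Scheme.Hom.image_top_eq_opensRange]
      exact (inf_eq_right.2 hW).symm⟩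
    exact (bijective_smul_restrict_iff M U W' _).1 (h W' le_top)
  · intro h W _
    exact (bijective_smul_restrict_iff M U W _).2
      (h (U.ι ''ᵁ W) (Scheme.Hom.image_mono _ le_top))

lemma exists_isGenerator_restrict_iff (M : X.Modules) (U : X.Opens) :
    (∃ σ, IsGenerator (M.restrict U.ι) ⊤ σ) ↔ ∃ σ, IsGenerator M U σ := by
  have : (∃ σ, IsGenerator (M.restrict U.ι) ⊤ σ) ↔ ∃ σ, IsGenerator M (U.ι ''ᵁ ⊤) σ :=
    exists_congr (isGenerator_restrict_iff M U)
  rw [this, Scheme.Hom.image_top_eq_opensRange, Scheme.Opens.opensRange_ι]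

lemma IsLineBundle.exists_isGenerator {M : X.Modules} (hM : IsLineBundle M) (x : X) :
    ∃ U : X.Opens, x ∈ U ∧ ∃ σ, IsGenerator M U σ := by
  obtain ⟨U, hx, ⟨e⟩⟩ := hM x
  exact ⟨U, hx, (exists_isGenerator_restrict_iff M U).1 (isGenerator_of_iso e)⟩

/-- A morphism from a module freely generated over `U` into a module which is the extension
of its restriction to `U` is given by an arbitrary image of the generator. -/
lemma IsGenerator.exists_hom {M N : X.Modules} {U : X.Opens} {σ : Γ(M, U)}
    (hσ : IsGenerator M U σ)
    (hN : ∀ W : X.Opens, Function.Bijective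
      (N.presheaf.map (homOfLE (inf_le_left : W ⊓ U ≤ W)).op)) (τ : Γ(N, U)) :
    ∃ f : M ⟶ N, f.app U σ = τ := by
  -- On `W ⊓ U` the section `y` is `c • σ`, so its image must be the unique extension to `W` of `c •
  -- τ`.
  have key : ∀ (W : X.Opens) (y : Γ(M, W)), ∃ z : Γ(N, W), ∃ c : Γ(X, W ⊓ U),
      M.presheaf.map (homOfLE inf_le_left).op y = c • M.presheaf.map (homOfLE inf_le_right).op σ ∧
      N.presheaf.map (homOfLE inf_le_left).op z =
        c • N.presheaf.map (homOfLE inf_le_right).op τ := by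
    intro W y
    obtain ⟨c, hc⟩ := (hσ (W ⊓ U) inf_le_right).2 (M.presheaf.map (homOfLE inf_le_left).op y)
    obtain ⟨z, hz⟩ := (hN W).2 (c • N.presheaf.map (homOfLE inf_le_right).op τ)
    exact ⟨z, c, hc.symm, hz⟩
  choose F C hC hF using key
  -- Uniqueness of the coefficient and of the extension reduces additivity, linearity, naturality
  -- and the value at `σ` to exhibiting a suitable coefficient.
  have huniq : ∀ (W : X.Opens) (y : Γ(M, W)) (z : Γ(N, W)) (c : Γ(X, W ⊓ U)),
      M.presheaf.map (homOfLE inf_le_left).op y = c • M.presheaf.map (homOfLE inf_le_right).op σ →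
      N.presheaf.map (homOfLE inf_le_left).op z =
        c • N.presheaf.map (homOfLE inf_le_right).op τ → F W y = z := by
    intro W y z c h1 h2
    have : C W y = c := (hσ (W ⊓ U) inf_le_right).1 ((hC W y).symm.trans h1)
    exact (hN W).1 ((hF W y).trans (by rw [this, h2]))
  refine ⟨⟨{ app := fun W => ModuleCat.ofHom (X := M.val.obj W) (Y := N.val.obj W)
              { toFun := fun y => F W.unop y
                map_add' := fun x y => ?_
                map_smul' := fun r x => ?_ }
             naturality := fun {W W'} i => ?_ }⟩, ?_⟩
  · refine huniq _ _ _ (C _ x + C _ y) ?_ ?_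
    · exact (map_add (M.presheaf.map (homOfLE inf_le_left).op).hom _ _).trans
        ((congr_arg₂ _ (hC _ x) (hC _ y)).trans (add_smul _ _ _).symm)
    · exact (map_add (N.presheaf.map (homOfLE inf_le_left).op).hom _ _).trans
        ((congr_arg₂ _ (hF _ x) (hF _ y)).trans (add_smul _ _ _).symm)
  · refine huniq _ _ _ (X.presheaf.map (homOfLE inf_le_left).op r * C _ x) ?_ ?_
    · exact (M.map_smul (homOfLE inf_le_left) r x).trans
        ((congr_arg _ (hC _ x)).trans (mul_smul _ _ _).symm)
    · exact (N.map_smul (homOfLE inf_le_left) r (F _ x)).trans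
        ((congr_arg _ (hF _ x)).trans (mul_smul _ _ _).symm)
  · ext x
    have hle : W'.unop ⊓ U ≤ W.unop ⊓ U := inf_le_inf_right U i.unop.le
    refine huniq W'.unop (M.presheaf.map (homOfLE i.unop.le).op x)
      (N.presheaf.map (homOfLE i.unop.le).op (F W.unop x))
      (X.presheaf.map (homOfLE hle).op (C W.unop x)) ?_ ?_
    · have := congr_arg (M.presheaf.map (homOfLE hle).op) (hC W.unop x)
      rw [Scheme.Modules.map_smul] at this
      exact (map_map M _ _ x).trans ((map_map M _ _ x).symm.trans
        (this.trans (congr_arg (_ • ·) (map_map M _ _ σ))))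
    · have := congr_arg (N.presheaf.map (homOfLE hle).op) (hF W.unop x)
      rw [Scheme.Modules.map_smul] at this
      exact (map_map N _ _ _).trans ((map_map N _ _ _).symm.trans
        (this.trans (congr_arg (_ • ·) (map_map N _ _ τ))))
  · refine huniq U σ τ 1 ?_ ?_
    · exact (one_smul _ _).symm
    · exact (one_smul _ _).symm

end Generators

end BondalQuiver

namespace BondalQuiver

/-! ### Morphisms from line bundles to the structure sheaf of a point -/

section PointSheaf

variable {k : Type u} [Field k] {V : Scheme.{u}} (p : Spec (.of k) ⟶ V)

lemma preimage_eq_top {U : V.Opens} (hU : p (IsLocalRing.closedPoint k) ∈ U) : p ⁻¹ᵁ U = ⊤ := by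
  refine top_le_iff.1 fun x _ => ?_
  have : x = IsLocalRing.closedPoint k := Subsingleton.elim (α := PrimeSpectrum k) _ _
  rw [this]
  exact hU

lemma bijective_map_of_eq {X : Scheme.{u}} (M : X.Modules) {U W : X.Opens} (h : W ≤ U)
    (e : W = U) : Function.Bijective (M.presheaf.map (homOfLE h).op) := by
  subst e
  have : ⇑(M.presheaf.map (homOfLE h).op) = id := funext fun x => map_refl M x
  rw [this]
  exact Function.bijective_id

/-- The sections of `𝒪_p` extend uniquely from an open neighbourhood of `p`. -/
lemma bijective_map_pointSheaf {U : V.Opens} (hU : p (IsLocalRing.closedPoint k) ∈ U)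
    (W : V.Opens) :
    Function.Bijective ((pointSheaf p).presheaf.map (homOfLE (inf_le_left : W ⊓ U ≤ W)).op) := by
  refine bijective_map_of_eq (X := Spec (.of k)) (unitModule _) (U := p ⁻¹ᵁ W)
    (W := p ⁻¹ᵁ (W ⊓ U)) (p.preimage_mono inf_le_left) ?_
  rw [Scheme.Hom.preimage_inf, preimage_eq_top p hU, inf_top_eq]

/-- A morphism into `𝒪_p` is determined by its values near `p`. -/
lemma hom_pointSheaf_eq_zero {M : V.Modules} {U : V.Opens}
    (hU : p (IsLocalRing.closedPoint k) ∈ U) {t : M ⟶ pointSheaf p}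
    (ht : ∀ W ≤ U, ∀ x, t.app W x = 0) : t = 0 := by
  ext W x
  refine (bijective_map_pointSheaf p hU W).1 ?_
  rw [← app_map, ht _ inf_le_right, Scheme.Modules.Hom.zero_app]
  exact (map_zero ((pointSheaf p).presheaf.map (homOfLE inf_le_left).op).hom).symm

/-- Sections of `𝒪_p` over a neighbourhood of `p` are scalars. -/
noncomputable def pointSheafEquiv {U : V.Opens}
    (hU : p (IsLocalRing.closedPoint k) ∈ U) :
    Γ(Spec (.of k), p ⁻¹ᵁ U) ≃+* k :=
  ((Spec (.of k)).presheaf.mapIso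
    (eqToIso (preimage_eq_top p hU)).op.symm ≪≫ Scheme.ΓSpecIso (.of k)).commRingCatIsoToRingEquiv

/-- Rationality of `p` enters here: the composite `Spec k ⟶ V ⟶ Spec k` is the identity. This makes
evaluation at a local generator `k`-linear. -/
lemma pointSheafEquiv_scalar [V.Over (Spec (.of k))]
    (hp : p ≫ (V ↘ Spec (.of k)) = 𝟙 _) {U : V.Opens}
    (hU : p (IsLocalRing.closedPoint k) ∈ U) (c : k) :
    pointSheafEquiv p hU (p.app U (V.presheaf.map U.leTop.op (scalar V c))) = c := by
  have key : (Scheme.ΓSpecIso (.of k)).inv ≫ (V ↘ Spec (.of k)).appTop ≫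
      V.presheaf.map U.leTop.op ≫ p.app U ≫
      (Spec (.of k)).presheaf.map (eqToHom (preimage_eq_top p hU).symm).op ≫
      (Scheme.ΓSpecIso (.of k)).hom = 𝟙 _ := by
    have h1 : (V ↘ Spec (.of k)).appTop ≫ p.appTop = 𝟙 _ := by
      rw [← Scheme.Hom.comp_appTop, hp, Scheme.Hom.id_appTop]
    have h2 : V.presheaf.map U.leTop.op ≫ p.app U ≫
        (Spec (.of k)).presheaf.map (eqToHom (preimage_eq_top p hU).symm).op = p.appTop := by
      rw [Scheme.Hom.naturality_assoc, ← Functor.map_comp]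
      exact (congrArg (p.appTop ≫ ·) ((Spec (.of k)).presheaf.map_id _)).trans
        (Category.comp_id _)
    rw [reassoc_of% h2, reassoc_of% h1, Iso.inv_hom_id]
  exact congr($key c)

lemma smul_app_pointSheaf [V.Over (Spec (.of k))] {M : V.Modules} (c : k)
    (t : M ⟶ pointSheaf p) (U : V.Opens) (x : Γ(M, U)) :
    (show Γ(Spec (.of k), p ⁻¹ᵁ U) from (c • t).app U x) =
      p.app U (V.presheaf.map U.leTop.op (scalar V c)) * (show Γ(Spec (.of k), p ⁻¹ᵁ U) from t.app U x) :=
  rfl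

/-- `Hom(M, 𝒪_p)` is one-dimensional if `M` is a line bundle. -/
lemma exists_linearEquiv [V.Over (Spec (.of k))]
    (hp : p ≫ (V ↘ Spec (.of k)) = 𝟙 _) {M : V.Modules} (hM : IsLineBundle M) :
    Nonempty ((M ⟶ pointSheaf p) ≃ₗ[k] k) := by
  obtain ⟨U, hU, σ, hσ⟩ := hM.exists_isGenerator (p (IsLocalRing.closedPoint k))
  refine ⟨LinearEquiv.ofBijective
    { toFun := fun t => pointSheafEquiv p hU (t.app U σ : Γ(Spec (.of k), p ⁻¹ᵁ U))
      map_add' := fun s t => map_add (pointSheafEquiv p hU) _ _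
      map_smul' := fun c t => ?_ } ⟨?_, ?_⟩⟩
  · exact (congrArg (pointSheafEquiv p hU) (smul_app_pointSheaf p c t U σ)).trans
      ((map_mul _ _ _).trans (congrArg (· * _) (pointSheafEquiv_scalar p hp hU c)))
  · rw [injective_iff_map_eq_zero]
    intro t ht
    have h0 : t.app U σ = 0 := (map_eq_zero_iff _ (pointSheafEquiv p hU).injective).1 ht
    refine hom_pointSheaf_eq_zero p hU fun W hW x => ?_
    obtain ⟨c, rfl⟩ := (hσ W hW).2 x
    simp only [Scheme.Modules.Hom.app_smul, app_map, h0, map_zero, smul_zero]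
  -- Any value can be prescribed on the generator, because sections of `𝒪_p` near `p` extend
  -- uniquely.
  · intro c
    obtain ⟨t, ht⟩ := hσ.exists_hom (bijective_map_pointSheaf p hU)
      ((pointSheafEquiv p hU).symm c : Γ(Spec (.of k), p ⁻¹ᵁ U))
    exact ⟨t, (congrArg (pointSheafEquiv p hU) ht).trans (RingEquiv.apply_symm_apply _ c)⟩

/-- If `𝓗om(M, N)` is globally generated, then some morphism `M ⟶ N` does not vanish at `p`. -/
lemma HomGloballyGenerated.exists_comp_ne_zero {M N : V.Modules} (h : HomGloballyGenerated M N)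
    (hM : IsLineBundle M) (hN : IsLineBundle N) {t : N ⟶ pointSheaf p} (ht : t ≠ 0) :
    ∃ s : M ⟶ N, s ≫ t ≠ 0 := by
  by_contra! H
  obtain ⟨U₁, hU₁, σ₁, hσ₁⟩ := hM.exists_isGenerator (p (IsLocalRing.closedPoint k))
  obtain ⟨U₂, hU₂, τ₂, hτ₂⟩ := hN.exists_isGenerator (p (IsLocalRing.closedPoint k))
  have hU : p (IsLocalRing.closedPoint k) ∈ U₁ ⊓ U₂ := ⟨hU₁, hU₂⟩
  have hM' : ∃ σ, IsGenerator M (U₁ ⊓ U₂) σ := ⟨_, hσ₁.map inf_le_left⟩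
  have hN' : ∃ σ, IsGenerator N (U₁ ⊓ U₂) σ := ⟨_, hτ₂.map inf_le_right⟩
  generalize U₁ ⊓ U₂ = U at hU hM' hN'
  obtain ⟨σ, hσ⟩ := (exists_isGenerator_restrict_iff M U).2 hM'
  obtain ⟨τ, hτ⟩ := (exists_isGenerator_restrict_iff N U).2 hN'
  -- The local isomorphism `M|_U ⟶ N|_U` matching generators; near `p` it is a combination of global
  -- morphisms, all of which `t` kills.
  obtain ⟨f, hf⟩ := hσ.exists_hom (fun W => bijective_map_of_eq _ inf_le_left (inf_top_eq W)) τ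
  obtain ⟨W, d, c, s, hW, hs⟩ := h U f ⟨_, hU⟩
  have hpW : p (IsLocalRing.closedPoint k) ∈ U.ι ''ᵁ W := ⟨_, hW, rfl⟩
  refine ht (hom_pointSheaf_eq_zero p hpW fun W₁ hW₁ x => ?_)
  obtain ⟨W', rfl⟩ : ∃ W', W₁ = U.ι ''ᵁ W' := ⟨U.ι ⁻¹ᵁ W₁, by
    rw [Scheme.Hom.image_preimage_eq_opensRange_inf, Scheme.Opens.opensRange_ι]
    exact (inf_eq_right.2 (hW₁.trans (U.ι_image_le W))).symm⟩
  have hW' : W' ≤ W := (U.ι.image_le_image_iff _ _).1 hW₁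
  obtain ⟨a, ha⟩ := (hτ W' le_top).2 x
  -- Every local section of `N` is in the image of `f`, so `t` vanishes near `p`.
  have hx : x = f.app W' (a • (M.restrict U.ι).presheaf.map (homOfLE le_top).op σ) := by
    rw [Scheme.Modules.Hom.app_smul, app_map, hf]
    exact ha.symm
  have hzero : ∀ (l : Fin d) (y : Γ(M.restrict U.ι, W')),
      ((Scheme.Modules.restrictFunctor U.ι).map t).app W'
        (((Scheme.Modules.restrictFunctor U.ι).map (s l)).app W' y) = 0 := fun l y =>
    congr(($(H (s l))).app (U.ι ''ᵁ W') y)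
  change ((Scheme.Modules.restrictFunctor U.ι).map t).app W'
    (show Γ(N.restrict U.ι, W') from x) = 0
  rw [hx, hs W' hW', map_sum]
  refine Finset.sum_eq_zero fun l _ => ?_
  rw [Scheme.Modules.Hom.app_smul, hzero, smul_zero]

end PointSheaf

end BondalQuiver

namespace BondalQuiver

/-! ### The tautological representation in coordinates -/

section Tautological

variable {k : Type u} [Field k] {V : Scheme.{u}} [V.Over (Spec (.of k))]
  {ι : Type v} [Quiver.{w} ι] {I : PathIdeal k ι} {E : ι → V.Modules}

lemma single_cons {i j l : ι} (q : Quiver.Path i j) (x : j ⟶ l) :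
    (Finsupp.single (q.cons x) 1 : PathSpace k i l) =
      PathSpace.comp (Finsupp.single q 1) (Finsupp.single x.toPath 1) := by
  rw [PathSpace.comp, Finsupp.sum_single_index (by simp), Finsupp.sum_single_index (by simp),
    mul_one]
  rfl

/-- In coordinates, the elements of the path algebra act on the functor `Hom(-, F)` by evaluation. -/
lemma PathAlgebraIso.comp_eq_evalPath (φ : PathAlgebraIso I E) {F : V.Modules}
    (e : ∀ i : ι, (E i ⟶ F) ≃ₗ[k] k) (a : ∀ {i j : ι}, (i ⟶ j) → k)
    (ha : ∀ {i j : ι} (x : i ⟶ j) (t : E i ⟶ F), e j (φ.arrow x ≫ t) = a x * e i t)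
    {i j : ι} (x : PathSpace k i j) (t : E i ⟶ F) :
    e j (φ.equiv i j (Submodule.Quotient.mk x) ≫ t) = evalPath a x * e i t := by
  -- By linearity single paths suffice; composition of morphisms then matches multiplication of the
  -- arrow scalars.
  have hpath : ∀ {j : ι} (q : Quiver.Path i j),
      e j (φ.equiv i j (Submodule.Quotient.mk (Finsupp.single q 1)) ≫ t) =
        q.weight a * e i t := by
    intro j q
    induction q with
    | nil => rw [φ.map_one, Category.id_comp, Quiver.Path.weight_nil, one_mul]
    | cons q x ih =>
      rw [single_cons, φ.map_comp, Category.assoc, ← PathAlgebraIso.arrow, ha, ih,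
        Quiver.Path.weight_cons]
      ring
  induction x using Finsupp.induction_linear with
  | zero =>
    rw [Submodule.Quotient.mk_zero, map_zero, Limits.zero_comp, map_zero]
    simp [evalPath]
  | add x y hx hy =>
    rw [Submodule.Quotient.mk_add, map_add, Preadditive.add_comp, map_add, hx, hy, ← add_mul]
    congr 1
    exact (Finsupp.sum_add_index' (by simp) (by intros; ring)).symm
  | single q c =>
    rw [show Finsupp.single q c = c • Finsupp.single q (1 : k) by simp,
      Submodule.Quotient.mk_smul, map_smul, Linear.smul_comp, map_smul, hpath]
    simp [evalPath, mul_assoc]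

/-- One-dimensional spaces `Hom(E_i, F)` give a representation on coordinate lines. -/
lemma PathAlgebraIso.exists_rep (φ : PathAlgebraIso I E) {F : V.Modules}
    (e : ∀ i : ι, (E i ⟶ F) ≃ₗ[k] k) :
    ∃ a : Rep I, ∀ {i j : ι} (x : i ⟶ j) (t : E i ⟶ F),
      e j (φ.arrow x ≫ t) = a.val x * e i t := by
  have ha : ∀ {i j : ι} (x : i ⟶ j) (t : E i ⟶ F),
      e j (φ.arrow x ≫ t) = e j (φ.arrow x ≫ (e i).symm 1) * e i t := by
    intro i j x t
    have : t = e i t • (e i).symm 1 := by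
      rw [← map_smul, smul_eq_mul, mul_one, LinearEquiv.symm_apply_apply]
    conv_lhs => rw [this, Linear.comp_smul, map_smul, smul_eq_mul, mul_comm]
  refine ⟨⟨fun {i j} x => e j (φ.arrow x ≫ (e i).symm 1), fun {i j} x hx => ?_⟩, ha⟩
  have := φ.comp_eq_evalPath e (fun {i j} x => e j (φ.arrow x ≫ (e i).symm 1)) ha x ((e i).symm 1)
  -- An element of the ideal gives the zero morphism, so its evaluation on the basis vector
  -- vanishes.
  rw [(Submodule.Quotient.mk_eq_zero _).2 hx, map_zero, Limits.zero_comp, map_zero,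
    LinearEquiv.apply_symm_apply, mul_one] at this
  exact this.symm

/-- A path along which the tautological representation does not vanish. -/
lemma HomGloballyGenerated.exists_path (hE : ∀ i, IsLineBundle (E i)) {φ : PathAlgebraIso I E}
    {p : Spec (.of k) ⟶ V} {a : Rep I} (ha : IsoTautological φ p a) {i j : ι}
    (h : HomGloballyGenerated (E i) (E j)) : ∃ q : Quiver.Path j i, q.weight a.val ≠ 0 := by
  obtain ⟨e, he⟩ := ha
  obtain ⟨s, hs⟩ := h.exists_comp_ne_zero p (hE i) (hE j) (t := (e j).symm 1)
    ((LinearEquiv.map_ne_zero_iff _).2 one_ne_zero)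
  -- The morphism is a combination of paths from `j` to `i`; if all their weights were zero, it
  -- would kill the basis vector at `j`.
  obtain ⟨x, rfl⟩ := (φ.equiv j i).surjective s
  obtain ⟨x, rfl⟩ := Submodule.Quotient.mk_surjective _ x
  have key := φ.comp_eq_evalPath e a.val he x ((e j).symm 1)
  rw [LinearEquiv.apply_symm_apply, mul_one] at key
  by_contra! h0
  refine (LinearEquiv.map_ne_zero_iff (e i)).2 hs (key.trans ?_)
  simp [evalPath, h0]

end Tautological

end BondalQuiver

theorem proposition2 {k : Type u} [Field k] [IsAlgClosed k]
    (V : Scheme.{u}) [V.Over (Spec (.of k))]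
    {ι : Type v} [Fintype ι] [Quiver.{w} ι] (I : BondalQuiver.PathIdeal k ι)
    (E : ι → V.Modules) (hE : ∀ i, BondalQuiver.IsLineBundle (E i))
    (φ : BondalQuiver.PathAlgebraIso I E)
    (m : ι → ι → ℕ) (hm : BondalQuiver.Sufficient E m) :
    BondalQuiver.IsGreat φ
      (BondalQuiver.character k (BondalQuiver.chi m) (BondalQuiver.sum_chi m)) := by
  refine fun p hp => ⟨?_, fun a ha => BondalQuiver.isStable_of_paths m a
    (fun i j h => (hm.1 i j h).exists_path hE ha)
    fun s t => Relation.ReflTransGen.mono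
      (fun _ _ => Or.imp_left fun h => h.exists_path hE ha) s t (hm.2 s t)⟩
  have e := fun i => (BondalQuiver.exists_linearEquiv p hp (hE i)).some
  obtain ⟨a, ha⟩ := φ.exists_rep e
  exact ⟨a, e, ha⟩
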